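/- Let $(\alpha_n)_{n\ge0}$ be the integer sequence of pseudo-factorials, defined by $\alpha_0=1$ and $\alpha_{n+1}=(-1)^{n+1}\sum_{k=0}^{n}\binom nk\alpha_k\alpha_{n-k}$ for $n\ge0$. For $j\ge 0$ put $c_j=(-1)^{j-1}\bigl(j+\tfrac{1+(-1)^j}{2}\bigr)$ and $a_j=-j^2\bigl(2-(-1)^j\bigr)$, and let $Q_m(z)\in\mathbb Z[z]$ be the denominators of the convergents of the continued fraction $$\cfrac{1}{1-c_0z-\cfrac{a_1z^2}{1-c_1z-\cfrac{a_2z^2}{\ddots}}},$$ that is, $Q_0=1$, $Q_1=1-c_0z$ and $Q_k=(1-c_{k-1}z)Q_{k-1}-a_{k-1}z^2Q_{k-2}$ for $k\ge2$. (i) For every integer $M\ge2$ the sequence $(\alpha_n \bmod M)$ is eventually periodic. (ii) For each $m\ge2$ the polynomial $Q_m$ has constant term $1$ and degree at most $m$, and modulo $M=3^{\lceil m/2\rceil}\,m!^2$ the sequence $(\alpha_n)$ satisfies a linear recurrence with constant coefficients of order at most $m$ with characteristic polynomial given by $Q_m$: writing $Q_m(z)=1+\sum_{i=1}^m b_i z^i$,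 one has $\alpha_{n+m}\equiv-\sum_{i=1}^m b_i\,\alpha_{n+m-i}\pmod M$ for all $n\ge0$; equivalently, the characteristic polynomial of the recurrence, in the usual normalization, is the reciprocal polynomial $z^mQ_m(1/z)$ reduced modulo $M$. -/

import Mathlib

open Polynomial
open scoped Nat

/-- The pseudo-factorials `α₀ = 1`, `αₙ₊₁ = (-1)ⁿ⁺¹ ∑_{k=0}^{n} (n choose k) αₖ αₙ₋ₖ`.
The sum over `k ∈ {0, …, n}` is indexed by `Fin (n + 1)`. -/
def pseudoFactorial : ℕ → ℤ
  | 0 => 1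
  | n + 1 => (-1) ^ (n + 1) *
      ∑ k : Fin (n + 1), (n.choose k : ℤ) * pseudoFactorial k * pseudoFactorial (n - k)

/-- The coefficients `c_j = (-1)^(j-1) (j + (1 + (-1)^j) / 2)` (the division is exact), that is
`-1, 1, -3, 3, -5, 5, …`, of the Jacobi continued fraction
`1 / (1 - c₀ z - a₁ z² / (1 - c₁ z - a₂ z² / ⋯))`. -/
def jacobiC (j : ℕ) : ℤ := (-1) ^ (j + 1) * (j + (1 + (-1) ^ j) / 2)

/-- The coefficients `a_j = -j² (2 - (-1)^j)`, that is `-3·1², -2², -3·3², -4², …` for `j ≥ 1`,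
of the same continued fraction. -/
def jacobiA (j : ℕ) : ℤ := -(j : ℤ) ^ 2 * (2 - (-1) ^ j)

/-- The denominators `Q_m(z)` of the convergents of the Jacobi continued fraction with
coefficients `c_j`, `a_j`:
`Q₀ = 1`, `Q₁ = 1 - c₀ z`, `Q_k = (1 - c_{k-1} z) Q_{k-1} - a_{k-1} z² Q_{k-2}`. -/
noncomputable def convergentDenom : ℕ → ℤ[X]
  | 0 => 1
  | 1 => 1 - C (jacobiC 0) * X
  | k + 2 => (1 - C (jacobiC (k + 1)) * X) * convergentDenom (k + 1)
      - C (jacobiA (k + 1)) * X ^ 2 * convergentDenom k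

/-!
Let `A(z)` be the exponential generating function of the pseudo-factorials and `B(z) = A(-z)`. The
defining recurrence reads `A' = -B²`, whence `B' = A²` and `A³ + B³ = 2`. Put `G = (1 - A B) / 3`,
`D = (B² - A) / 3`, and let `f_k` be the `k`-th member of `A, D, A G, D G, A G², D G², …` divided
by `k!`. The cubic relation makes `d/dz` act on the `f_k` through the tridiagonal matrix of the
continued fraction: `f_k' = f_{k-1} + c_k f_k + a_{k+1} f_{k+1}`. Therefore `P_m(d/dz) A = a_1 ⋯
a_m f_m`, where `P_m` is the reciprocal polynomial of `Q_m`. As the tridiagonal matrix is integral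
and `f_k(0)` is `0` or `1`, the numbers `n! [zⁿ] f_m` are integers, so `a_1 ⋯ a_m = ± 3^⌈m/2⌉ m!²`
divides `∑ p_i α_{n+i}`, where `P_m = ∑ p_i xⁱ`. Since `M` divides `a_M`, this gives a recurrence
modulo every `M`, and a recurrence over a finite ring has eventually periodic solutions.
-/

open scoped PowerSeries

section LinearRecurrence

variable {R S : Type*} [Semiring R] [CommRing S]

/-- The linear recurrence `∑ i ≤ d, f (q.coeff i) * u (n + i) = 0` attached to a monic polynomial
`q` of degree `d`, with coefficients transported along a ring homomorphism `f`. Keeping `q` over `R`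
lets the order be `q.natDegree` even when `S` is trivial. -/
def polynomialRecurrence (f : R →+* S) (q : R[X]) : LinearRecurrence S where
  order := q.natDegree
  coeffs i := -f (q.coeff i)

theorem charPoly_polynomialRecurrence (f : R →+* S) {q : R[X]} (hq : q.Monic) :
    (polynomialRecurrence f q).charPoly = q.map f := by
  conv_rhs => rw [q.as_sum_range, Finset.sum_range_succ, hq.coeff_natDegree, Finset.sum_range]
  simp only [LinearRecurrence.charPoly, polynomialRecurrence, monomial_neg, Finset.sum_neg_distrib,
    sub_neg_eq_add, Polynomial.map_add, Polynomial.map_sum, map_monomial, map_one]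
  rw [add_comm]
  rfl

theorem isSolution_polynomialRecurrence_iff (f : R →+* S) {q : R[X]} (hq : q.Monic) (u : ℕ → R) :
    (polynomialRecurrence f q).IsSolution (fun n => f (u n)) ↔
      ∀ n, f (∑ i ∈ Finset.range (q.natDegree + 1), q.coeff i * u (n + i)) = 0 := by
  refine forall_congr' fun n => ?_
  rw [Finset.sum_range_succ, hq.coeff_natDegree, one_mul, Finset.sum_range, map_add,
    add_comm (f _), add_eq_zero_iff_eq_neg]
  simp only [polynomialRecurrence, map_sum, map_mul, neg_mul, Finset.sum_neg_distrib]
  rfl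

theorem exists_eventually_periodic_of_isSolution {A : Type*} [CommSemiring A] [Finite A]
    {E : LinearRecurrence A} {u : ℕ → A} (hu : E.IsSolution u) :
    ∃ p : ℕ, 0 < p ∧ ∃ N : ℕ, ∀ n : ℕ, N ≤ n → u (n + p) = u n := by
  obtain ⟨a, b, hab, hwindow⟩ : ∃ a b : ℕ, a < b ∧ ∀ i : Fin E.order, u (a + i) = u (b + i) := by
    obtain ⟨a, b, hab, h⟩ := Finite.exists_ne_map_eq_of_infinite
      fun n : ℕ => fun i : Fin E.order => u (n + i)
    rcases hab.lt_or_gt with hab | hab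
    · exact ⟨a, b, hab, congrFun h⟩
    · exact ⟨b, a, hab, congrFun h.symm⟩
  have hshift (c : ℕ) : E.IsSolution fun n => u (c + n) := fun n => by
    simpa only [add_assoc] using hu (c + n)
  have htail : (fun n => u (a + n)) = fun n => u (b + n) :=
    (E.eq_iff_eqOn_range_order _ _ (hshift a) (hshift b)).2 fun i hi =>
      hwindow ⟨i, by simpa using hi⟩
  refine ⟨b - a, by omega, a, fun n hn => ?_⟩
  convert (congrFun htail (n - a)).symm using 2 <;> omega

end LinearRecurrence

section JacobiChain

variable {R V : Type*} [CommRing R] [AddCommGroup V] [Module R V]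

/-- The monic orthogonal polynomials with recurrence coefficients `c` and `a`, that is the
reciprocals of the convergent denominators of the corresponding Jacobi continued fraction. -/
noncomputable def orthogonalPoly (c a : ℕ → R) : ℕ → R[X]
  | 0 => 1
  | 1 => X - C (c 0)
  | k + 2 => (X - C (c (k + 1))) * orthogonalPoly c a (k + 1)
      - C (a (k + 1)) * orthogonalPoly c a k

/-- A sequence of vectors on which the endomorphism `T` acts through the tridiagonal matrix of a
Jacobi continued fraction. With `T` the derivative of power series, this is Stieltjes's system for
the exponential generating functions of the columns of the expansion. -/
structure IsJacobiChain (T : Module.End R V) (c a : ℕ → R) (v : ℕ → V) : Prop where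
  map_zero : T (v 0) = c 0 • v 0 + a 1 • v 1
  map_succ (k : ℕ) : T (v (k + 1)) = v k + c (k + 1) • v (k + 1) + a (k + 2) • v (k + 2)

namespace IsJacobiChain

variable {T : Module.End R V} {c a : ℕ → R} {v : ℕ → V}

theorem aeval_orthogonalPoly (h : IsJacobiChain T c a v) (m : ℕ) :
    aeval T (orthogonalPoly c a m) (v 0) = (∏ j ∈ Finset.range m, a (j + 1)) • v m := by
  induction m using Nat.twoStepInduction with
  | zero => simp [orthogonalPoly]
  | one => simp [orthogonalPoly, h.map_zero]
  | more m ih₀ ih₁ =>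
    simp only [orthogonalPoly, map_sub, map_mul, aeval_X, aeval_C, LinearMap.sub_apply,
      Module.End.mul_apply, Module.algebraMap_end_apply, ih₀, ih₁, map_smul, h.map_succ,
      Finset.prod_range_succ]
    module

theorem map_pow_mem {M : Type*} [AddCommMonoid M] [Module R M] (h : IsJacobiChain T c a v)
    (ℓ : V →ₗ[R] M) {N : Submodule R M} (hN : ∀ k, ℓ (v k) ∈ N) (n k : ℕ) :
    ℓ ((T ^ n) (v k)) ∈ N := by
  induction n generalizing k with
  | zero => exact hN k
  | succ n ih =>
    rw [pow_succ, Module.End.mul_apply]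
    cases k with
    | zero =>
      simp only [h.map_zero, map_add, map_smul]
      exact N.add_mem (N.smul_mem _ (ih 0)) (N.smul_mem _ (ih 1))
    | succ k =>
      simp only [h.map_succ, map_add, map_smul]
      exact N.add_mem (N.add_mem (ih k) (N.smul_mem _ (ih _))) (N.smul_mem _ (ih _))

theorem prod_dvd_sum_coeff_orthogonalPoly {S : Type*} [Semiring S] [Algebra R S]
    (h : IsJacobiChain T c a v) (hinj : Function.Injective (algebraMap R S)) (ℓ : V →ₗ[R] S)
    (hℓ : ∀ k, ℓ (v k) ∈ LinearMap.range (Algebra.linearMap R S)) {u : ℕ → R}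
    (hu : ∀ n, ℓ ((T ^ n) (v 0)) = algebraMap R S (u n)) (m n : ℕ) :
    ∏ j ∈ Finset.range m, a (j + 1) ∣
      ∑ i ∈ Finset.range ((orthogonalPoly c a m).natDegree + 1),
        (orthogonalPoly c a m).coeff i * u (n + i) := by
  obtain ⟨w, hw⟩ := h.map_pow_mem ℓ hℓ n m
  refine ⟨w, hinj ?_⟩
  calc algebraMap R S (∑ i ∈ _, (orthogonalPoly c a m).coeff i * u (n + i))
    _ = ℓ ((T ^ n) (aeval T (orthogonalPoly c a m) (v 0))) := by
      simp [aeval_eq_sum_range, ← hu, pow_add, Algebra.smul_def]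
    _ = algebraMap R S ((∏ j ∈ Finset.range m, a (j + 1)) * w) := by
      rw [h.aeval_orthogonalPoly, map_smul, map_smul, ← hw, map_mul, Algebra.smul_def,
        Algebra.linearMap_apply]

end IsJacobiChain

end JacobiChain

section ConvergentDenom

theorem natDegree_convergentDenom_le (m : ℕ) : (convergentDenom m).natDegree ≤ m := by
  induction m using Nat.twoStepInduction with
  | zero => simp [convergentDenom]
  | one =>
    rw [convergentDenom]
    compute_degree
  | more m ih₀ ih₁ =>
    rw [convergentDenom]
    compute_degree
    omega

theorem coeff_zero_convergentDenom (m : ℕ) : (convergentDenom m).coeff 0 = 1 := by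
  induction m using Nat.twoStepInduction with
  | zero => simp [convergentDenom]
  | one => simp [convergentDenom]
  | more m _ ih => simp [convergentDenom, mul_coeff_zero, ih]

theorem reflect_one_sub_C_mul_X {R : Type*} [Ring R] (c : R) :
    (1 - C c * X : R[X]).reflect 1 = X - C c := by
  simp [reflect_sub, reflect_C_mul]

theorem reflect_convergentDenom (m : ℕ) :
    (convergentDenom m).reflect m = orthogonalPoly jacobiC jacobiA m := by
  induction m using Nat.twoStepInduction with
  | zero => simp [convergentDenom, orthogonalPoly]
  | one => rw [convergentDenom, orthogonalPoly, reflect_one_sub_C_mul_X]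
  | more m ih₀ ih₁ =>
    have hlin : (1 - C (jacobiC (m + 1)) * X : ℤ[X]).natDegree ≤ 1 := by compute_degree
    have h₁ := reflect_mul _ _ hlin (natDegree_convergentDenom_le (m + 1))
    have h₀ := reflect_mul _ _ (natDegree_X_pow_le 2) (natDegree_convergentDenom_le m)
    rw [show 1 + (m + 1) = m + 2 by ring, reflect_one_sub_C_mul_X, ih₁] at h₁
    rw [show 2 + m = m + 2 by ring, ih₀] at h₀
    rw [convergentDenom, orthogonalPoly, reflect_sub, h₁, mul_assoc, reflect_C_mul, h₀]
    simp [reflect_monomial]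

theorem natDegree_reflect_convergentDenom_le (m : ℕ) :
    ((convergentDenom m).reflect m).natDegree ≤ m :=
  natDegree_reflect_le.trans (max_le le_rfl (natDegree_convergentDenom_le m))

theorem coeff_reflect_convergentDenom_self (m : ℕ) :
    ((convergentDenom m).reflect m).coeff m = 1 := by
  rw [coeff_reflect, revAt_le le_rfl, Nat.sub_self, coeff_zero_convergentDenom]

theorem monic_reflect_convergentDenom (m : ℕ) : ((convergentDenom m).reflect m).Monic :=
  monic_of_natDegree_le_of_coeff_eq_one m (natDegree_reflect_convergentDenom_le m)
    (coeff_reflect_convergentDenom_self m)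

theorem natDegree_reflect_convergentDenom (m : ℕ) :
    ((convergentDenom m).reflect m).natDegree = m :=
  natDegree_eq_of_le_of_coeff_ne_zero (natDegree_reflect_convergentDenom_le m)
    (by rw [coeff_reflect_convergentDenom_self]; exact one_ne_zero)

theorem natCast_dvd_jacobiA (j : ℕ) : (j : ℤ) ∣ jacobiA j :=
  ⟨-(j * (2 - (-1) ^ j)), by rw [jacobiA]; ring⟩

theorem natCeil_natCast_div_two (m : ℕ) : ⌈(m : ℚ) / 2⌉₊ = (m + 1) / 2 := by
  refine eq_of_forall_ge_iff fun c => ?_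
  rw [Nat.ceil_le, div_le_iff₀ two_pos]
  norm_cast
  omega

theorem prod_jacobiA (m : ℕ) : ∏ j ∈ Finset.range m, jacobiA (j + 1) =
    (-1) ^ m * (3 ^ ⌈(m : ℚ) / 2⌉₊ * m ! ^ 2 : ℕ) := by
  rw [natCeil_natCast_div_two]
  induction m with
  | zero => simp
  | succ m ih =>
    rw [Finset.prod_range_succ, Nat.factorial_succ, ih, jacobiA]
    obtain ⟨k, rfl | rfl⟩ := m.even_or_odd'
    · rw [show (2 * k + 1 + 1) / 2 = k + 1 by omega, show (2 * k + 1) / 2 = k by omega]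
      push_cast
      simp only [pow_succ, pow_mul, pow_zero, one_mul, neg_one_mul, neg_neg, one_pow]
      ring
    · rw [show (2 * k + 1 + 1 + 1) / 2 = k + 1 by omega, show (2 * k + 1 + 1) / 2 = k + 1 by omega]
      push_cast
      simp only [pow_succ, pow_mul, pow_zero, one_mul, neg_one_mul, neg_neg, one_pow]
      ring

end ConvergentDenom

section GeneratingFunction

theorem derivative_rescale {R : Type*} [CommSemiring R] (r : R) (f : R⟦X⟧) :
    d⁄dX R (PowerSeries.rescale r f) = r • PowerSeries.rescale r (d⁄dX R f) := by
  ext n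
  simp only [PowerSeries.coeff_derivative, PowerSeries.coeff_rescale, PowerSeries.coeff_smul,
    smul_eq_mul, pow_succ]
  ring

/-- The exponential generating function `A(z)` of the pseudo-factorials. -/
noncomputable def pseudoExp : ℚ⟦X⟧ := PowerSeries.mk fun n => (pseudoFactorial n : ℚ) / n !

/-- The series `A(-z)`. -/
noncomputable def pseudoExpNeg : ℚ⟦X⟧ := PowerSeries.rescale (-1) pseudoExp

theorem constantCoeff_pseudoExp : PowerSeries.constantCoeff pseudoExp = 1 := by
  simp [pseudoExp, pseudoFactorial, ← PowerSeries.coeff_zero_eq_constantCoeff_apply]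

theorem constantCoeff_pseudoExpNeg : PowerSeries.constantCoeff pseudoExpNeg = 1 := by
  rw [pseudoExpNeg, ← PowerSeries.coeff_zero_eq_constantCoeff_apply, PowerSeries.coeff_rescale,
    pow_zero, one_mul, PowerSeries.coeff_zero_eq_constantCoeff_apply, constantCoeff_pseudoExp]

theorem factorial_mul_coeff_pseudoExp (n : ℕ) :
    (n ! : ℚ) * PowerSeries.coeff n pseudoExp = pseudoFactorial n := by
  rw [pseudoExp, PowerSeries.coeff_mk, mul_div_cancel₀ _ (by positivity)]

theorem pseudoFactorial_succ (n : ℕ) : pseudoFactorial (n + 1) = (-1) ^ (n + 1) *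
    ∑ p ∈ Finset.HasAntidiagonal.antidiagonal n,
      (n.choose p.1 : ℤ) * pseudoFactorial p.1 * pseudoFactorial p.2 := by
  rw [pseudoFactorial, Finset.Nat.sum_antidiagonal_eq_sum_range_succ
    (fun i j => (n.choose i : ℤ) * pseudoFactorial i * pseudoFactorial j), Finset.sum_range]

theorem coeff_pseudoExp_sq (n : ℕ) : PowerSeries.coeff n (pseudoExp ^ 2) =
    (-1) ^ (n + 1) * (pseudoFactorial (n + 1) : ℚ) / n ! := by
  rw [pseudoFactorial_succ, sq, PowerSeries.coeff_mul]
  push_cast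
  rw [← mul_assoc, ← mul_pow, neg_one_mul, neg_neg, one_pow, one_mul, Finset.sum_div]
  refine Finset.sum_congr rfl fun p hp => ?_
  obtain rfl := Finset.HasAntidiagonal.mem_antidiagonal.1 hp
  rw [Nat.cast_add_choose]
  simp only [pseudoExp, PowerSeries.coeff_mk]
  field_simp

theorem derivative_pseudoExp : d⁄dX ℚ pseudoExp = -pseudoExpNeg ^ 2 := by
  ext n
  rw [pseudoExpNeg, ← map_pow, map_neg, PowerSeries.coeff_rescale, coeff_pseudoExp_sq,
    PowerSeries.coeff_derivative, pseudoExp, PowerSeries.coeff_mk, Nat.factorial_succ,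
    mul_div_assoc, ← mul_assoc, ← pow_add, Odd.neg_one_pow ⟨n, by ring⟩]
  push_cast
  field_simp

theorem derivative_pseudoExpNeg : d⁄dX ℚ pseudoExpNeg = pseudoExp ^ 2 := by
  rw [pseudoExpNeg, derivative_rescale, derivative_pseudoExp, pseudoExpNeg, map_neg, map_pow,
    PowerSeries.rescale_rescale]
  simp

theorem pseudoExp_cube_add_pseudoExpNeg_cube : pseudoExp ^ 3 + pseudoExpNeg ^ 3 = 2 := by
  refine PowerSeries.derivative.ext ?_ ?_
  · simp only [map_add, PowerSeries.derivative_pow, derivative_pseudoExp, derivative_pseudoExpNeg,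
      ← Nat.cast_ofNat (R := ℚ⟦X⟧) (n := 2), Derivation.map_natCast]
    push_cast
    ring
  · simp only [map_add, map_pow, map_ofNat, constantCoeff_pseudoExp, constantCoeff_pseudoExpNeg]
    norm_num

/-- The series `(1 - A(z) A(-z)) / 3`, the ratio of pseudo-columns two apart. -/
noncomputable def pseudoGap : ℚ⟦X⟧ := (3⁻¹ : ℚ) • (1 - pseudoExp * pseudoExpNeg)

/-- The series `k! f_k(z)`, where `f_k` is the `k`-th member of the Jacobi chain of the derivative
that starts at `f_0 = A`. -/
noncomputable def pseudoColumn : ℕ → ℚ⟦X⟧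
  | 0 => pseudoExp
  | 1 => (3⁻¹ : ℚ) • (pseudoExpNeg ^ 2 - pseudoExp)
  | k + 2 => pseudoColumn k * pseudoGap

theorem constantCoeff_pseudoColumn_succ (k : ℕ) :
    PowerSeries.constantCoeff (pseudoColumn (k + 1)) = 0 := by
  cases k <;> simp [pseudoColumn, pseudoGap, constantCoeff_pseudoExp, constantCoeff_pseudoExpNeg]

theorem pseudoColumn_zero : pseudoColumn 0 = pseudoExp := rfl

theorem pseudoColumn_add_two (k : ℕ) : pseudoColumn (k + 2) = pseudoColumn k * pseudoGap := rfl

theorem three_mul_inv_three_smul (f : ℚ⟦X⟧) : 3 * (3⁻¹ : ℚ) • f = f := by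
  rw [mul_smul_comm, ← smul_mul_assoc]
  simp [Algebra.smul_def, ← map_ofNat (algebraMap ℚ ℚ⟦X⟧) 3, ← map_mul]

theorem three_mul_pseudoGap : 3 * pseudoGap = 1 - pseudoExp * pseudoExpNeg :=
  three_mul_inv_three_smul _

theorem three_mul_derivative_pseudoGap :
    3 * d⁄dX ℚ pseudoGap = pseudoExpNeg ^ 3 - pseudoExp ^ 3 := by
  rw [pseudoGap, Derivation.map_smul, three_mul_inv_three_smul, map_sub, Derivation.leibniz,
    Derivation.map_one_eq_zero, derivative_pseudoExp, derivative_pseudoExpNeg, smul_eq_mul,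
    smul_eq_mul]
  ring

theorem three_mul_pseudoColumn_one : 3 * pseudoColumn 1 = pseudoExpNeg ^ 2 - pseudoExp :=
  three_mul_inv_three_smul _

theorem three_mul_derivative_pseudoColumn_one :
    3 * d⁄dX ℚ (pseudoColumn 1) = 2 * pseudoExp ^ 2 * pseudoExpNeg + pseudoExpNeg ^ 2 := by
  rw [pseudoColumn, Derivation.map_smul, three_mul_inv_three_smul, map_sub, sq pseudoExpNeg,
    Derivation.leibniz, derivative_pseudoExp, derivative_pseudoExpNeg, smul_eq_mul]
  ring

theorem pseudoColumn_zero_mul_derivative_pseudoGap :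
    pseudoColumn 0 * d⁄dX ℚ pseudoGap =
      2 * pseudoColumn 1 - 2 * pseudoColumn 2 - 6 * pseudoColumn 3 := by
  have : CharZero ℚ⟦X⟧ := algebraRat.charZero _
  refine mul_left_cancel₀ (by norm_num : (3 : ℚ⟦X⟧) ≠ 0) ?_
  rw [pseudoColumn_add_two 0, pseudoColumn_add_two 1, pseudoColumn_zero]
  linear_combination pseudoExp * three_mul_derivative_pseudoGap
    + (6 * pseudoGap - 2) * three_mul_pseudoColumn_one
    + 2 * pseudoExpNeg ^ 2 * three_mul_pseudoGap
    - pseudoExp * pseudoExp_cube_add_pseudoExpNeg_cube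

theorem pseudoColumn_one_mul_derivative_pseudoGap :
    pseudoColumn 1 * d⁄dX ℚ pseudoGap =
      2 * pseudoColumn 2 + 2 * pseudoColumn 3 - 2 * pseudoColumn 4 := by
  have : CharZero ℚ⟦X⟧ := algebraRat.charZero _
  refine mul_left_cancel₀ (by norm_num : (9 : ℚ⟦X⟧) ≠ 0) ?_
  rw [pseudoColumn_add_two 2, pseudoColumn_add_two 0, pseudoColumn_add_two 1, pseudoColumn_zero]
  linear_combination (3 * d⁄dX ℚ pseudoGap - 6 * pseudoGap) * three_mul_pseudoColumn_one
    + (pseudoExpNeg ^ 2 - pseudoExp) * three_mul_derivative_pseudoGap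
    + (2 * pseudoExp * (3 * pseudoGap + 1 - pseudoExp * pseudoExpNeg)
      - 2 * pseudoExpNeg ^ 2 - 4 * pseudoExp) * three_mul_pseudoGap
    + (pseudoExpNeg ^ 2 + pseudoExp) * pseudoExp_cube_add_pseudoExpNeg_cube

theorem pseudoColumn_mul_derivative_pseudoGap (k : ℕ) :
    pseudoColumn k * d⁄dX ℚ pseudoGap = 2 * pseudoColumn (k + 1)
      - 2 * (-1) ^ k * pseudoColumn (k + 2) - 2 * (2 + (-1) ^ k) * pseudoColumn (k + 3) := by
  induction k using Nat.twoStepInduction with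
  | zero => linear_combination pseudoColumn_zero_mul_derivative_pseudoGap
  | one => linear_combination pseudoColumn_one_mul_derivative_pseudoGap
  | more k ih _ =>
    simp only [pseudoColumn_add_two] at ih ⊢
    linear_combination pseudoGap * ih

theorem jacobiC_add_two (k : ℕ) : jacobiC (k + 2) = jacobiC k - 2 * (-1) ^ k := by
  simp only [jacobiC, pow_succ]
  push_cast
  ring_nf

theorem derivative_pseudoColumn (k : ℕ) :
    d⁄dX ℚ (pseudoColumn k) = k * pseudoColumn (k - 1) + jacobiC k * pseudoColumn k
      - (k + 1) * (2 + (-1) ^ k) * pseudoColumn (k + 1) := by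
  have : CharZero ℚ⟦X⟧ := algebraRat.charZero _
  induction k using Nat.twoStepInduction with
  | zero =>
    rw [pseudoColumn_zero, derivative_pseudoExp, show jacobiC 0 = -1 by simp [jacobiC]]
    push_cast
    linear_combination three_mul_pseudoColumn_one
  | one =>
    refine mul_left_cancel₀ (by norm_num : (3 : ℚ⟦X⟧) ≠ 0) ?_
    rw [show jacobiC 1 = 1 by simp [jacobiC], pseudoColumn_add_two 0, Nat.sub_self,
      pseudoColumn_zero]
    push_cast
    linear_combination three_mul_derivative_pseudoColumn_one - three_mul_pseudoColumn_one
      + 2 * pseudoExp * three_mul_pseudoGap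
  | more k ih _ =>
    have hpred : (k : ℚ⟦X⟧) * pseudoColumn (k - 1) * pseudoGap = k * pseudoColumn (k + 1) := by
      cases k with
      | zero => simp
      | succ k => rw [Nat.add_sub_cancel, mul_assoc, ← pseudoColumn_add_two]
    have hgap := pseudoColumn_mul_derivative_pseudoGap k
    rw [jacobiC_add_two, pseudoColumn_add_two k, Derivation.leibniz, smul_eq_mul, smul_eq_mul, ih,
      show k + 2 - 1 = k + 1 by omega]
    simp only [pseudoColumn_add_two] at hgap ⊢
    push_cast
    linear_combination hpred + hgap

theorem isJacobiChain_pseudoColumn :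
    IsJacobiChain ((d⁄dX ℚ).toLinearMap.restrictScalars ℤ) jacobiC jacobiA
      fun k => (k ! : ℚ)⁻¹ • pseudoColumn k := by
  have hderiv (k : ℕ) : d⁄dX ℚ (pseudoColumn k) = (k : ℚ) • pseudoColumn (k - 1)
      + (jacobiC k : ℚ) • pseudoColumn k
      - ((k + 1) * (2 + (-1) ^ k) : ℚ) • pseudoColumn (k + 1) := by
    simp only [derivative_pseudoColumn, Algebra.smul_def, map_mul, map_add, map_pow, map_neg,
      map_natCast, map_intCast, map_one, map_ofNat]
  constructor
  · simp only [LinearMap.coe_restrictScalars, Derivation.coeFn_coe, map_smul, hderiv, jacobiA,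
      ← Int.cast_smul_eq_zsmul ℚ, Nat.factorial_zero, Nat.factorial_one]
    push_cast
    module
  · intro k
    simp only [LinearMap.coe_restrictScalars, Derivation.coeFn_coe, map_smul, hderiv, jacobiA,
      ← Int.cast_smul_eq_zsmul ℚ, Nat.factorial_succ, Nat.add_sub_cancel]
    push_cast
    match_scalars <;> field_simp
    all_goals ring

end GeneratingFunction

theorem prod_jacobiA_dvd_sum_coeff_orthogonalPoly_mul_pseudoFactorial (m n : ℕ) :
    ∏ j ∈ Finset.range m, jacobiA (j + 1) ∣
      ∑ i ∈ Finset.range ((orthogonalPoly jacobiC jacobiA m).natDegree + 1),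
        (orthogonalPoly jacobiC jacobiA m).coeff i * pseudoFactorial (n + i) := by
  refine isJacobiChain_pseudoColumn.prod_dvd_sum_coeff_orthogonalPoly (S := ℚ)
    Int.cast_injective ((PowerSeries.coeff 0).restrictScalars ℤ) ?_ ?_ m n
  · rintro (_ | k)
    · exact ⟨1, by simp [pseudoColumn, constantCoeff_pseudoExp]⟩
    · exact ⟨0, by simp [constantCoeff_pseudoColumn_succ]⟩
  · intro n
    simpa [pseudoColumn_zero, Module.End.pow_apply] using
      (PowerSeries.constantCoeff_iterate_derivative _ n).trans (factorial_mul_coeff_pseudoExp n)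

theorem isSolution_polynomialRecurrence_pseudoFactorial {m M : ℕ}
    (hM : (M : ℤ) ∣ ∏ j ∈ Finset.range m, jacobiA (j + 1)) :
    (polynomialRecurrence (Int.castRingHom (ZMod M)) ((convergentDenom m).reflect m)).IsSolution
      (fun n => (pseudoFactorial n : ZMod M)) := by
  refine (isSolution_polynomialRecurrence_iff _ (monic_reflect_convergentDenom m) _).2 fun n => ?_
  rw [eq_intCast, ZMod.intCast_zmod_eq_zero_iff_dvd, reflect_convergentDenom]
  exact hM.trans (prod_jacobiA_dvd_sum_coeff_orthogonalPoly_mul_pseudoFactorial m n)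

/-- (i) The pseudo-factorials are eventually periodic modulo every `M ≥ 2`.
(ii) For `m ≥ 2`, modulo `M = 3^⌈m/2⌉ m!²`, they satisfy a linear recurrence
`u (n + m) = ∑_{i < m} e_i u (n + i)` for all `n ≥ 0`, with constant coefficients, whose
characteristic polynomial `x^m - ∑_{i < m} e_i x^i` is the reciprocal polynomial `x^m Q_m(1/x)` of
the convergent denominator `Q_m`, reduced modulo `M`. (Some of the last coefficients may vanish
modulo `M`, so this is a recurrence of order at most `m`.) -/
theorem corollary9 :
    (∀ M : ℕ, 2 ≤ M → ∃ p : ℕ, 0 < p ∧ ∃ N : ℕ, ∀ n : ℕ, N ≤ n →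
      pseudoFactorial (n + p) ≡ pseudoFactorial n [ZMOD M]) ∧
    (∀ m : ℕ, 2 ≤ m →
      (convergentDenom m).coeff 0 = 1 ∧ (convergentDenom m).natDegree ≤ m ∧
      ∃ E : LinearRecurrence (ZMod (3 ^ ⌈(m : ℚ) / 2⌉₊ * m ! ^ 2)),
        E.order = m ∧
        E.charPoly = ((convergentDenom m).reflect m).map
          (Int.castRingHom (ZMod (3 ^ ⌈(m : ℚ) / 2⌉₊ * m ! ^ 2))) ∧
        E.IsSolution (fun n => (pseudoFactorial n :
          ZMod (3 ^ ⌈(m : ℚ) / 2⌉₊ * m ! ^ 2)))) := by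
  refine ⟨fun M hM => ?_, fun m _ => ⟨coeff_zero_convergentDenom m, natDegree_convergentDenom_le m,
    polynomialRecurrence (Int.castRingHom _) ((convergentDenom m).reflect m),
    natDegree_reflect_convergentDenom m,
    charPoly_polynomialRecurrence _ (monic_reflect_convergentDenom m),
    isSolution_polynomialRecurrence_pseudoFactorial (Dvd.intro_left _ (prod_jacobiA m).symm)⟩⟩
  obtain ⟨k, rfl⟩ : ∃ k, M = k + 1 := ⟨M - 1, by omega⟩
  have hdvd : ((k + 1 : ℕ) : ℤ) ∣ ∏ j ∈ Finset.range (k + 1), jacobiA (j + 1) :=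
    (natCast_dvd_jacobiA (k + 1)).trans
      (Finset.dvd_prod_of_mem (fun j => jacobiA (j + 1)) (Finset.self_mem_range_succ k))
  obtain ⟨p, hp, N, hperiod⟩ := exists_eventually_periodic_of_isSolution
    (isSolution_polynomialRecurrence_pseudoFactorial hdvd)
  exact ⟨p, hp, N, fun n hn => (ZMod.intCast_eq_intCast_iff _ _ _).1 (hperiod n hn)⟩
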